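/- Let $[m]=\{1,\dots,m\}$. For $n\ge 1$ let $\mathcal A_{3n}$ be the set of permutations $\pi=\pi_1\pi_2\cdots\pi_{3n}$ of $[3n]$ such that - every cycle of $\pi$ has length exactly $3$ (so $\pi$ is a product of $n$ disjoint $3$-cycles and has no fixed points); - $\pi$ avoids the pattern $132$, i.e. there are no positions $i<j<k$ with $\pi_i<\pi_k<\pi_j$; - every $3$-cycle of $\pi$ is of the form $312$, i.e. if the elements of the cycle are $a<b<c$, then $\pi_a\pi_b\pi_c$ is in the same relative order as $312$ (equivalently, $\pi_a=c$, $\pi_b=a$, $\pi_c=b$). Let $C_j$ denote the $j$-th Catalan number and $M_j$ the $j$-th Motzkin number, that is, the number of lattice paths from $(0,0)$ to $(j,0)$ with steps $(1,1)$, $(1,0)$, $(1,-1)$ that never go below the $x$-axis. Let $c(x)=\sum_{j\ge 0}C_jx^j$ and $m(x)=\sum_{j\ge 0}M_jx^j$ be their generating functions, and let $\mathcal P_{n,k}$ be the set of compositions of $n$ of length $k$, i.e. of sequences $(x_1,\dots,x_k)$ of positive integers with $x_1+\cdots+x_k=n$. Then for all $n\ge 1$, $$|\mathcal A_{3n}|=\sum_{k=1}^{n}M_{k-1}\sum_{(x_1,\dots,x_k)\in\mathcal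 P_{n,k}}C_{x_1}C_{x_2}\cdots C_{x_k}.$$ Furthermore, the generating function $A(x)=\sum_{n\ge 1}|\mathcal A_{3n}|x^n$ satisfies, as an identity of formal power series, $$A(x)=(c(x)-1)\,m(c(x)-1).$$ -/

import Mathlib

/-- `IsOccurrence π σ f`: the subsequence of (the one-line notation of) the permutation `π` of an
`n`-element chain read at the positions `f 0 < f 1 < ⋯ < f (k - 1)` is in the same relative order
as the word `σ 0, σ 1, …, σ (k - 1)`. -/
def IsOccurrence {n k : ℕ} (π : Equiv.Perm (Fin n)) (σ : Fin k → ℕ) (f : Fin k ↪o Fin n) : Prop :=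
  ∀ i j : Fin k, π (f i) < π (f j) ↔ σ i < σ j

/-- `π` avoids the pattern `σ`. -/
def AvoidsPattern {n k : ℕ} (π : Equiv.Perm (Fin n)) (σ : Fin k → ℕ) : Prop :=
  ∀ f : Fin k ↪o Fin n, ¬ IsOccurrence π σ f

/-- The cycle `c` of `π` is of the form `σ`: the elements of the cycle, read in `π` from left to
right, are an occurrence of the pattern `σ`. -/
def CycleHasForm {n k : ℕ} (π c : Equiv.Perm (Fin n)) (σ : Fin k → ℕ) : Prop :=
  ∃ f : Fin k ↪o Fin n, Set.range f = (c.support : Set (Fin n)) ∧ IsOccurrence π σ f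

/-- The permutations of a `3n`-element chain that are composed only of 3-cycles (`n` of them, so
that there is no fixed point). -/
def ThreeCyclePerms (n : ℕ) : Set (Equiv.Perm (Fin (3 * n))) :=
  {π | π.cycleType = Multiset.replicate n 3}

/-- The 132-avoiding permutations composed only of 3-cycles, all of them of the form 312. -/
def A (n : ℕ) : Set (Equiv.Perm (Fin (3 * n))) :=
  {π | π ∈ ThreeCyclePerms n ∧ AvoidsPattern π ![1, 3, 2] ∧
    ∀ c ∈ π.cycleFactorsFinset, CycleHasForm π c ![3, 1, 2]}

/-- The steps of a Motzkin path: up `(1, 1)`, flat `(1, 0)`, down `(1, -1)`. -/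
inductive MotzkinStep where
  | U
  | F
  | D

/-- The change of height along a step. -/
def MotzkinStep.rise : MotzkinStep → ℤ
  | U => 1
  | F => 0
  | D => -1

/-- A word of steps is a Motzkin path if it never goes below height `0` and ends at height `0`. -/
def IsMotzkinPath (w : List MotzkinStep) : Prop :=
  (∀ i : ℕ, 0 ≤ ((w.take i).map MotzkinStep.rise).sum) ∧ (w.map MotzkinStep.rise).sum = 0

/-- The Motzkin number `M_n`: the number of Motzkin paths of length `n`. -/
noncomputable def motzkin (n : ℕ) : ℕ :=
  {w : List MotzkinStep | w.length = n ∧ IsMotzkinPath w}.ncard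

/-- The compositions of `n` of length `k`. -/
def compositionsOfLength (n k : ℕ) : Finset (Composition n) :=
  Finset.univ.filter fun X => X.length = k

/-- The generating function `c(x)` of the Catalan numbers. -/
noncomputable def catalanGF : PowerSeries ℤ :=
  PowerSeries.mk fun n => (catalan n : ℤ)

/-- The generating function `m(x)` of the Motzkin numbers. -/
noncomputable def motzkinGF : PowerSeries ℤ :=
  PowerSeries.mk fun n => (motzkin n : ℤ)

/-- The generating function `A(x) = ∑_{n ≥ 1} |A n| xⁿ`; the sum starts at `n = 1`. -/
noncomputable def AGF : PowerSeries ℤ :=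
  PowerSeries.mk fun n => if n = 0 then 0 else ((A n).ncard : ℤ)

/-- `c(x) - 1` has no constant term, so that the composition `m(c(x) - 1)` makes sense. -/
theorem hasSubst_catalanGF_sub_one : PowerSeries.HasSubst (catalanGF - 1) := by
  apply PowerSeries.HasSubst.of_constantCoeff_zero'
  rw [map_sub, map_one, ← PowerSeries.coeff_zero_eq_constantCoeff_apply, catalanGF,
    PowerSeries.coeff_mk, catalan_zero, Nat.cast_one, sub_self]

/-!
In `π ∈ A n`, avoiding `132` forces the smallest elements of the cycles to be `0, …, n - 1`, and
`π` maps the largest elements increasingly to the middle ones. So `π` is determined by the relative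
order `σ` of its values at the middle elements, and by how the middle and the largest elements
interleave, recorded by a monotone function `f`. The pairs `(σ, f)` grow by inserting a new first
entry. This makes them the nodes of a generating tree with labels `(u, r)`: the root has the labels
`(1, 2)`, and a node `(u, r)` has the children `(i + 2, r)` for `i < u` and `(1, i + 2)` for
`i < r`.

Let `T = (c - 1) m(c - 1)`. The equations `c = 1 + x c²` and `m = 1 + x m + x² m²` give
`T = x c (1 + T)²`. Hence summing geometric progressions shows that the power series
`cᵘ (1 + T)ʳ` satisfy the recursion for the generating function, by the number of generations, of
the descendants of a node `(u, r)`. At the root it is `c (1 + T)²`, and `x c (1 + T)² = T`.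
-/

/-! ### Motzkin paths -/

/-- The words of `n` steps that lead from height `h` to height `0` without going below `0`. The
height is an integer so that a step down from height `0` needs no special treatment. -/
def motzkinPathsFrom (n : ℕ) (h : ℤ) : Set (List MotzkinStep) :=
  {w | w.length = n ∧ (∀ i : ℕ, 0 ≤ h + ((w.take i).map MotzkinStep.rise).sum) ∧
    h + (w.map MotzkinStep.rise).sum = 0}

theorem cons_mem_motzkinPathsFrom_succ {n : ℕ} {h : ℤ} {s : MotzkinStep} {w : List MotzkinStep} :
    s :: w ∈ motzkinPathsFrom (n + 1) h ↔ 0 ≤ h ∧ w ∈ motzkinPathsFrom n (h + s.rise) := by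
  have heights : (∀ i : ℕ, 0 ≤ h + (((s :: w).take i).map MotzkinStep.rise).sum) ↔
      0 ≤ h ∧ ∀ i : ℕ, 0 ≤ h + s.rise + ((w.take i).map MotzkinStep.rise).sum := by
    refine ⟨fun H => ⟨by simpa using H 0, fun i => by simpa [add_assoc] using H (i + 1)⟩, ?_⟩
    rintro ⟨h0, H⟩ (_ | i)
    · simpa using h0
    · simpa [add_assoc] using H i
  simp only [motzkinPathsFrom, Set.mem_ofPred_eq, heights, List.length_cons,
    Nat.add_right_cancel_iff, List.map_cons, List.sum_cons, add_assoc]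
  tauto

theorem motzkinPathsFrom_of_neg (n : ℕ) {h : ℤ} (hh : h < 0) : motzkinPathsFrom n h = ∅ :=
  Set.eq_empty_of_forall_notMem fun _ hw => hh.not_ge (by simpa using hw.2.1 0)

theorem motzkinPathsFrom_zero (h : ℤ) : motzkinPathsFrom 0 h = if h = 0 then {[]} else ∅ := by
  ext w
  split_ifs with hh <;> simp +contextual [motzkinPathsFrom, List.length_eq_zero_iff, hh]

theorem motzkinPathsFrom_succ (n : ℕ) {h : ℤ} (hh : 0 ≤ h) :
    motzkinPathsFrom (n + 1) h =
      List.cons .U '' motzkinPathsFrom n (h + 1) ∪ List.cons .F '' motzkinPathsFrom n h ∪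
        List.cons .D '' motzkinPathsFrom n (h - 1) := by
  ext w
  rcases w with _ | ⟨_ | _ | _, w⟩
  · simp [motzkinPathsFrom]
  all_goals
    simp [cons_mem_motzkinPathsFrom_succ, hh, MotzkinStep.rise, sub_eq_add_neg]

instance : Finite MotzkinStep :=
  .of_surjective ![MotzkinStep.U, .F, .D] <| by
    rintro (_ | _ | _)
    exacts [⟨0, rfl⟩, ⟨1, rfl⟩, ⟨2, rfl⟩]

theorem finite_motzkinPathsFrom (n : ℕ) (h : ℤ) : (motzkinPathsFrom n h).Finite :=
  (List.finite_length_eq MotzkinStep n).subset fun _ hw => hw.1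

theorem disjoint_image_cons {α : Type*} {a b : α} (hab : a ≠ b) (s t : Set (List α)) :
    Disjoint (List.cons a '' s) (List.cons b '' t) := by
  rw [Set.disjoint_left]
  rintro _ ⟨_, -, rfl⟩ ⟨_, -, h⟩
  exact hab (List.cons.inj h).1.symm

theorem ncard_motzkinPathsFrom_succ (n : ℕ) {h : ℤ} (hh : 0 ≤ h) :
    (motzkinPathsFrom (n + 1) h).ncard =
      (motzkinPathsFrom n (h + 1)).ncard + (motzkinPathsFrom n h).ncard +
        (motzkinPathsFrom n (h - 1)).ncard := by
  have finite_cons (s : MotzkinStep) (h : ℤ) : (List.cons s '' motzkinPathsFrom n h).Finite :=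
    (finite_motzkinPathsFrom n h).image _
  rw [motzkinPathsFrom_succ n hh,
    Set.ncard_union_eq _ ((finite_cons _ _).union (finite_cons _ _)) (finite_cons _ _),
    Set.ncard_union_eq (disjoint_image_cons (by simp) _ _) (finite_cons _ _) (finite_cons _ _)]
  · simp only [Set.ncard_image_of_injective _ List.cons_injective]
  · exact (disjoint_image_cons (by simp) _ _).union_left (disjoint_image_cons (by simp) _ _)

/-- The generating function by length of the Motzkin paths that start at height `h`. -/
noncomputable def motzkinFromGF (h : ℤ) : PowerSeries ℤ :=
  PowerSeries.mk fun n => ((motzkinPathsFrom n h).ncard : ℤ)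

theorem motzkinFromGF_zero : motzkinFromGF 0 = motzkinGF := by
  ext n
  simp [motzkinFromGF, motzkinGF, motzkin, motzkinPathsFrom, IsMotzkinPath]

theorem motzkinFromGF_of_neg {h : ℤ} (hh : h < 0) : motzkinFromGF h = 0 := by
  ext n
  simp [motzkinFromGF, motzkinPathsFrom_of_neg n hh]

theorem motzkinFromGF_eq {h : ℤ} (hh : 0 ≤ h) :
    motzkinFromGF h = (if h = 0 then 1 else 0) +
      PowerSeries.X * (motzkinFromGF (h + 1) + motzkinFromGF h + motzkinFromGF (h - 1)) := by
  ext (_ | n)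
  · by_cases h0 : h = 0 <;> simp [motzkinFromGF, motzkinPathsFrom_zero, h0]
  · split_ifs <;> simp [motzkinFromGF, ncard_motzkinPathsFrom_succ n hh, PowerSeries.coeff_one,
      PowerSeries.coeff_succ_X_mul]

theorem eq_zero_of_eq_X_mul_neighbors {R : Type*} [Semiring R] (E : ℕ → PowerSeries R)
    (h0 : E 0 = PowerSeries.X * (E 1 + E 0))
    (hs : ∀ h, E (h + 1) = PowerSeries.X * (E (h + 2) + E (h + 1) + E h)) (h : ℕ) : E h = 0 := by
  ext n
  induction n generalizing h with
  | zero =>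
    rcases h with _ | h
    · rw [h0, PowerSeries.coeff_zero_X_mul, map_zero]
    · rw [hs, PowerSeries.coeff_zero_X_mul, map_zero]
  | succ n ih =>
    rcases h with _ | h
    · rw [h0, PowerSeries.coeff_succ_X_mul]
      simp only [map_add, ih, map_zero, add_zero]
    · rw [hs, PowerSeries.coeff_succ_X_mul]
      simp only [map_add, ih, map_zero, add_zero]

theorem motzkinGF_eq_motzkinFromGF_one :
    motzkinGF = 1 + PowerSeries.X * (motzkinFromGF 1 + motzkinGF) := by
  have h := motzkinFromGF_eq (h := 0) le_rfl
  rwa [if_pos rfl, zero_add, zero_sub, motzkinFromGF_of_neg neg_one_lt_zero, add_zero,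
    motzkinFromGF_zero] at h

theorem motzkinFromGF_natCast_succ (h : ℕ) : motzkinFromGF (h + 1) =
    PowerSeries.X * (motzkinFromGF (h + 2) + motzkinFromGF (h + 1) + motzkinFromGF h) := by
  have eq := motzkinFromGF_eq (h := (h : ℤ) + 1) (by lia)
  rwa [if_neg (by lia), zero_add, add_sub_cancel_right, add_assoc (h : ℤ), one_add_one_eq_two] at eq

-- A path from height `h + 1` is a path down to height `h`, cut at its first visit there, followed
-- by a path from height `h`. Instead of cutting paths, compare the linear recurrences in `h`.
theorem motzkinFromGF_succ (h : ℕ) :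
    motzkinFromGF (h + 1) = PowerSeries.X * motzkinGF * motzkinFromGF h := by
  refine sub_eq_zero.1 (eq_zero_of_eq_X_mul_neighbors
    (fun k : ℕ => motzkinFromGF (k + 1) - PowerSeries.X * motzkinGF * motzkinFromGF k) ?_ ?_ h)
  · have step := motzkinFromGF_natCast_succ 0
    simp only [Nat.cast_zero, Nat.cast_one, zero_add, one_add_one_eq_two,
      motzkinFromGF_zero] at step ⊢
    linear_combination step - PowerSeries.X * motzkinGF * motzkinGF_eq_motzkinFromGF_one
  · intro k
    have step := motzkinFromGF_natCast_succ (k + 1)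
    push_cast at step ⊢
    simp only [add_assoc, Int.reduceAdd] at step ⊢
    linear_combination step - PowerSeries.X * motzkinGF * motzkinFromGF_natCast_succ k

theorem motzkinGF_eq :
    motzkinGF = 1 + PowerSeries.X * motzkinGF + PowerSeries.X ^ 2 * motzkinGF ^ 2 := by
  have hone : motzkinFromGF 1 = PowerSeries.X * motzkinGF * motzkinGF := by
    simpa only [Nat.cast_zero, zero_add, motzkinFromGF_zero] using motzkinFromGF_succ 0
  linear_combination motzkinGF_eq_motzkinFromGF_one + PowerSeries.X * hone

/-! ### The power series `(c - 1) m(c - 1)` -/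

theorem catalanGF_eq : catalanGF = 1 + PowerSeries.X * catalanGF ^ 2 := by
  have map_catalanSeries :
      PowerSeries.map (Nat.castRingHom ℤ) PowerSeries.catalanSeries = catalanGF := by
    ext n
    simp [catalanGF]
  have h := congrArg (PowerSeries.map (Nat.castRingHom ℤ))
    PowerSeries.catalanSeries_sq_mul_X_add_one
  simp only [map_add, map_mul, map_pow, map_one, PowerSeries.map_X, map_catalanSeries] at h
  linear_combination -h

theorem constantCoeff_catalanGF_sub_one : PowerSeries.constantCoeff (catalanGF - 1) = 0 := by
  rw [← PowerSeries.coeff_zero_eq_constantCoeff_apply]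
  simp [catalanGF]

/-- The composition of `x m(x)` with `c(x) - 1`, the generating function claimed for `A`. -/
noncomputable def catalanMotzkinGF : PowerSeries ℤ :=
  (catalanGF - 1) * PowerSeries.subst (catalanGF - 1) motzkinGF

theorem catalanMotzkinGF_eq_subst :
    catalanMotzkinGF = PowerSeries.subst (catalanGF - 1) (PowerSeries.X * motzkinGF) := by
  rw [PowerSeries.subst_mul hasSubst_catalanGF_sub_one,
    PowerSeries.subst_X hasSubst_catalanGF_sub_one, catalanMotzkinGF]

theorem constantCoeff_catalanMotzkinGF : PowerSeries.constantCoeff catalanMotzkinGF = 0 := by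
  rw [catalanMotzkinGF, map_mul, constantCoeff_catalanGF_sub_one, zero_mul]

theorem subst_motzkinGF_eq :
    PowerSeries.subst (catalanGF - 1) motzkinGF =
      1 + (catalanGF - 1) * PowerSeries.subst (catalanGF - 1) motzkinGF +
        (catalanGF - 1) ^ 2 * PowerSeries.subst (catalanGF - 1) motzkinGF ^ 2 := by
  have h := congrArg (PowerSeries.substAlgHom hasSubst_catalanGF_sub_one (R := ℤ)) motzkinGF_eq
  simp only [map_add, map_mul, map_pow, map_one, PowerSeries.substAlgHom_X] at h
  rwa [PowerSeries.coe_substAlgHom] at h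

theorem catalanMotzkinGF_eq :
    catalanMotzkinGF = PowerSeries.X * catalanGF * (1 + catalanMotzkinGF) ^ 2 := by
  have catalanGF_ne_zero : catalanGF ≠ 0 := fun h => by
    simpa [h] using constantCoeff_catalanGF_sub_one
  have motzkin_eq : catalanMotzkinGF =
      (catalanGF - 1) * (1 + catalanMotzkinGF + catalanMotzkinGF ^ 2) := by
    unfold catalanMotzkinGF
    linear_combination (catalanGF - 1) * subst_motzkinGF_eq
  refine mul_left_cancel₀ catalanGF_ne_zero ?_
  linear_combination motzkin_eq + (1 + catalanMotzkinGF) ^ 2 * catalanGF_eq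

theorem mem_compositionsOfLength {n k : ℕ} {X : Composition n} :
    X ∈ compositionsOfLength n k ↔ X.length = k := by
  simp [compositionsOfLength]

theorem coeff_pow_eq_sum_compositionsOfLength {R : Type*} [CommSemiring R] {p : PowerSeries R}
    (hp : PowerSeries.constantCoeff p = 0) (n k : ℕ) :
    PowerSeries.coeff n (p ^ k) =
      ∑ X ∈ compositionsOfLength n k, (X.blocks.map fun i => PowerSeries.coeff i p).prod := by
  have pos_of_prod_ne_zero (l : Fin k →₀ ℕ) (hl : ∏ i, PowerSeries.coeff (l i) p ≠ 0) (i : Fin k) :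
      0 < l i := by
    refine Nat.pos_of_ne_zero fun h => hl (Finset.prod_eq_zero (Finset.mem_univ i) ?_)
    rwa [h, PowerSeries.coeff_zero_eq_constantCoeff_apply]
  rw [← Fin.prod_const, PowerSeries.coeff_prod,
    ← Finset.sum_filter_of_ne fun l _ hl => pos_of_prod_ne_zero l hl]
  refine Finset.sum_bij (fun l hl => ⟨List.ofFn l, ?_, ?_⟩) ?_ ?_ ?_ ?_
  · intro j hj
    obtain ⟨i, rfl⟩ := (List.mem_ofFn' _ _).1 hj
    exact (Finset.mem_filter.1 hl).2 i
  · rw [List.sum_ofFn]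
    exact (Finset.mem_finsuppAntidiag.1 (Finset.mem_filter.1 hl).1).1
  · exact fun l _ => mem_compositionsOfLength.2 List.length_ofFn
  · exact fun l _ l' _ h => DFunLike.coe_injective (List.ofFn_injective (congrArg (·.blocks) h))
  · intro X hX
    obtain rfl := mem_compositionsOfLength.1 hX
    refine ⟨Finsupp.equivFunOnFinite.symm X.blocksFun, ?_, Composition.ext ?_⟩
    · simp [Finset.mem_finsuppAntidiag, X.sum_blocksFun, X.one_le_blocksFun, Nat.succ_le_iff.symm]
    · simp [X.ofFn_blocksFun]
  · intro l _
    simp [List.map_ofFn, List.prod_ofFn]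

theorem coeff_catalanGF_sub_one_pow (n k : ℕ) :
    PowerSeries.coeff n ((catalanGF - 1) ^ k) =
      ∑ X ∈ compositionsOfLength n k, ((X.blocks.map catalan).prod : ℤ) := by
  have coeff_eq_catalan {i : ℕ} (hi : 0 < i) :
      PowerSeries.coeff i (catalanGF - 1) = (catalan i : ℤ) := by
    simp [catalanGF, PowerSeries.coeff_one, hi.ne']
  rw [coeff_pow_eq_sum_compositionsOfLength constantCoeff_catalanGF_sub_one]
  refine Finset.sum_congr rfl fun X _ => ?_
  rw [Nat.cast_list_prod, List.map_map,
    List.map_congr_left fun i hi => coeff_eq_catalan (X.blocks_pos hi)]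
  rfl

theorem coeff_catalanMotzkinGF (n : ℕ) :
    PowerSeries.coeff n catalanMotzkinGF =
      ((∑ k ∈ Finset.Icc 1 n, motzkin (k - 1) *
          ∑ X ∈ compositionsOfLength n k, (X.blocks.map catalan).prod : ℕ) : ℤ) := by
  rw [catalanMotzkinGF_eq_subst, PowerSeries.coeff_subst' hasSubst_catalanGF_sub_one,
    finsum_eq_sum_of_support_subset (s := Finset.Icc 1 n), Nat.cast_sum]
  · refine Finset.sum_congr rfl fun k hk => ?_
    obtain ⟨j, rfl⟩ := Nat.exists_eq_add_of_le' (Finset.mem_Icc.1 hk).1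
    simp [coeff_catalanGF_sub_one_pow, PowerSeries.coeff_succ_X_mul, motzkinGF]
  · intro k hk
    rw [Finset.coe_Icc, Set.mem_Icc]
    constructor
    · refine Nat.one_le_iff_ne_zero.2 ?_
      rintro rfl
      simp at hk
    · by_contra! hnk
      refine hk ?_
      beta_reduce
      rw [PowerSeries.coeff_of_lt_order n, smul_zero]
      exact (Nat.cast_lt.2 hnk).trans_le
        (PowerSeries.le_order_pow_of_constantCoeff_eq_zero k constantCoeff_catalanGF_sub_one)

/-! ### Admissible pairs and their generating tree -/

/-- The permutation with value `v` at `0` whose remaining values are in the same relative order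
as those of `σ`. -/
def insertFirst {n : ℕ} (v : Fin (n + 1)) (σ : Equiv.Perm (Fin n)) : Equiv.Perm (Fin (n + 1)) :=
  (finSuccEquiv' 0).trans ((Equiv.optionCongr σ).trans (finSuccEquiv' v).symm)

/-- The permutation `σ` has no positions `i < j < k` with `σ i < σ k < σ j`. -/
def Avoids132 {n : ℕ} (σ : Equiv.Perm (Fin n)) : Prop :=
  ∀ i j k, i < j → j < k → σ i < σ k → ¬ σ k < σ j

/-- No pair `p < q` with `σ p < σ q` is separated by the gap before position `s`: all the values
before position `s` are larger than those from `s` on. -/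
def IsCut {n : ℕ} (σ : Equiv.Perm (Fin n)) (s : ℕ) : Prop :=
  ∀ p q, p < q → σ p < σ q → (p : ℕ) < s → (q : ℕ) < s

/-- The pairs that encode the elements of `A n`: `σ` is the relative order of the values at the
middle elements of the cycles, and `f p` is the number of middle elements before the `p`-th
largest element of a cycle. -/
structure IsAdmissible {n : ℕ} (σ : Equiv.Perm (Fin n)) (f : Fin n → ℕ) : Prop where
  avoids132 : Avoids132 σ
  monotone : Monotone f
  lt : ∀ p : Fin n, (p : ℕ) < f p
  le : ∀ p, f p ≤ n
  eq_of_ascent : ∀ p q, p < q → σ p < σ q → f p = f q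
  isCut : ∀ p, IsCut σ (f p)

section InsertFirst

variable {n : ℕ}

@[simp]
theorem insertFirst_zero (v : Fin (n + 1)) (σ : Equiv.Perm (Fin n)) : insertFirst v σ 0 = v := by
  simp [insertFirst]

@[simp]
theorem insertFirst_succ (v : Fin (n + 1)) (σ : Equiv.Perm (Fin n)) (i : Fin n) :
    insertFirst v σ i.succ = v.succAbove (σ i) := by
  rw [insertFirst, Equiv.trans_apply, ← Fin.succAbove_zero_apply, finSuccEquiv'_succAbove]
  simp

theorem insertFirst_injective :
    Function.Injective2 (insertFirst : Fin (n + 1) → Equiv.Perm (Fin n) → _) := by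
  intro v w σ τ h
  obtain rfl : v = w := by simpa using DFunLike.congr_fun h 0
  exact ⟨rfl, Equiv.ext fun i => by simpa using DFunLike.congr_fun h i.succ⟩

theorem exists_insertFirst_eq (τ : Equiv.Perm (Fin (n + 1))) : ∃ v σ, insertFirst v σ = τ := by
  have bijective : Function.Bijective (Function.uncurry (insertFirst (n := n))) := by
    rw [Fintype.bijective_iff_injective_and_card]
    exact ⟨insertFirst_injective.uncurry, by simp [Fintype.card_perm, Nat.factorial_succ]⟩
  obtain ⟨⟨v, σ⟩, h⟩ := bijective.2 τ
  exact ⟨v, σ, h⟩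

theorem insertFirst_zero_lt_succ {v : Fin (n + 1)} {σ : Equiv.Perm (Fin n)} {i : Fin n} :
    insertFirst v σ 0 < insertFirst v σ i.succ ↔ v ≤ (σ i).castSucc := by
  rw [insertFirst_zero, insertFirst_succ, Fin.lt_succAbove_iff_le_castSucc]

theorem insertFirst_succ_lt_succ {v : Fin (n + 1)} {σ : Equiv.Perm (Fin n)} {i j : Fin n} :
    insertFirst v σ i.succ < insertFirst v σ j.succ ↔ σ i < σ j := by
  rw [insertFirst_succ, insertFirst_succ, Fin.succAbove_lt_succAbove_iff]

theorem forall_ascent_insertFirst {v : Fin (n + 1)} {σ : Equiv.Perm (Fin n)}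
    {P : Fin (n + 1) → Fin (n + 1) → Prop} :
    (∀ p q, p < q → insertFirst v σ p < insertFirst v σ q → P p q) ↔
      (∀ q, v ≤ (σ q).castSucc → P 0 q.succ) ∧ ∀ p q, p < q → σ p < σ q → P p.succ q.succ := by
  simp only [Fin.forall_fin_succ, insertFirst_zero_lt_succ, insertFirst_succ_lt_succ,
    Fin.succ_lt_succ_iff, Fin.succ_pos, Fin.not_lt_zero, false_imp_iff, true_imp_iff,
    true_and]

theorem isCut_insertFirst {v : Fin (n + 1)} {σ : Equiv.Perm (Fin n)} {s : ℕ} :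
    IsCut (insertFirst v σ) (s + 1) ↔ (∀ q, v ≤ (σ q).castSucc → (q : ℕ) < s) ∧ IsCut σ s := by
  simp [IsCut, forall_ascent_insertFirst]

theorem forall_ascent_eq_insertFirst {v : Fin (n + 1)} {σ : Equiv.Perm (Fin n)} {t : ℕ}
    {f : Fin n → ℕ} :
    (∀ p q, p < q → insertFirst v σ p < insertFirst v σ q →
        (Fin.cons (t + 1) (fun i => f i + 1) : Fin (n + 1) → ℕ) p =
          (Fin.cons (t + 1) (fun i => f i + 1) : Fin (n + 1) → ℕ) q) ↔
      (∀ q, v ≤ (σ q).castSucc → t = f q) ∧ ∀ p q, p < q → σ p < σ q → f p = f q := by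
  simp [forall_ascent_insertFirst]

variable {v : Fin (n + 2)} {σ : Equiv.Perm (Fin (n + 1))}

theorem avoids132_insertFirst :
    Avoids132 (insertFirst v σ) ↔ Avoids132 σ ∧ (σ 0).castSucc ≤ v := by
  have split : Avoids132 (insertFirst v σ) ↔
      (∀ j k, j < k → v ≤ (σ k).castSucc → ¬ σ k < σ j) ∧ Avoids132 σ := by
    simp only [Avoids132, Fin.forall_fin_succ (n := n + 1), insertFirst_zero_lt_succ,
      insertFirst_succ_lt_succ, Fin.succ_lt_succ_iff, Fin.succ_pos, Fin.not_lt_zero, false_imp_iff,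
      true_imp_iff, implies_true, true_and]
  rw [split, and_comm]
  refine and_congr_right fun hσ => ⟨fun h => ?_, fun hv j k hjk hvk hkj => ?_⟩
  · by_contra! hlt
    obtain ⟨w, rfl⟩ := Fin.exists_castSucc_eq.2 ((hlt.trans_le (Fin.le_last _)).ne)
    obtain ⟨k, rfl⟩ := σ.surjective w
    rw [Fin.castSucc_lt_castSucc_iff] at hlt
    exact h 0 k (Fin.pos_iff_ne_zero.2 fun hk => hlt.ne (congrArg σ hk)) le_rfl hlt
  · have h0k : σ 0 ≤ σ k := Fin.castSucc_le_castSucc_iff.1 (hv.trans hvk)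
    rcases (Fin.zero_le j).eq_or_lt with rfl | hj
    · exact hkj.not_ge h0k
    · exact hσ 0 j k hj hjk (h0k.lt_of_ne (σ.injective.ne (hj.trans hjk).ne)) hkj

-- Everything not below `v` is then joined to position `0` by an ascent, or is position `0`.
theorem forall_le_apply_iff (hv : (σ 0).castSucc ≤ v) {Q : Fin (n + 1) → Prop}
    (hQ : ∀ q, 0 < q → σ 0 < σ q → (Q 0 ↔ Q q)) :
    (∀ q, v ≤ (σ q).castSucc → Q q) ↔ (v ≠ Fin.last _ → Q 0) := by
  have iff_zero (q) (hq : v ≤ (σ q).castSucc) : Q 0 ↔ Q q := by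
    rcases (Fin.zero_le q).eq_or_lt with rfl | hq0
    · rfl
    · exact hQ q hq0 ((Fin.castSucc_le_castSucc_iff.1 (hv.trans hq)).lt_of_ne
        (σ.injective.ne hq0.ne))
  constructor
  · intro h hlast
    obtain ⟨w, rfl⟩ := Fin.exists_castSucc_eq.2 hlast
    obtain ⟨q, rfl⟩ := σ.surjective w
    exact (iff_zero q le_rfl).2 (h q le_rfl)
  · exact fun h q hq => (iff_zero q hq).1 (h (hq.trans_lt (Fin.castSucc_lt_last _)).ne)

theorem isCut_insertFirst_iff_of_le (hv : (σ 0).castSucc ≤ v) {s : ℕ} :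
    IsCut (insertFirst v σ) (s + 1) ↔ (v ≠ Fin.last _ → 0 < s) ∧ IsCut σ s := by
  rw [isCut_insertFirst]
  refine and_congr_left fun hs => ?_
  exact forall_le_apply_iff hv (Q := fun q => (q : ℕ) < s) fun q hq hσ =>
    ⟨hs 0 q hq hσ, fun h => (Nat.zero_le _).trans_lt h⟩

theorem monotone_cons_succ {t : ℕ} {f : Fin (n + 1) → ℕ} :
    Monotone (Fin.cons (t + 1) (fun i => f i + 1) : Fin (n + 2) → ℕ) ↔ t ≤ f 0 ∧ Monotone f := by
  simp [Fin.monotone_iff_le_succ, Fin.forall_fin_succ (n := n)]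

theorem isAdmissible_insertFirst {t : ℕ} {f : Fin (n + 1) → ℕ} :
    IsAdmissible (insertFirst v σ) (Fin.cons (t + 1) fun i => f i + 1) ↔
      IsAdmissible σ f ∧ (σ 0).castSucc ≤ v ∧ t ≤ f 0 ∧ IsCut σ t ∧ (v ≠ Fin.last _ → t = f 0) := by
  constructor
  · intro h
    obtain ⟨hσ, hv⟩ := avoids132_insertFirst.1 h.avoids132
    obtain ⟨ht, hf⟩ := monotone_cons_succ.1 h.monotone
    obtain ⟨hlast, heq⟩ := forall_ascent_eq_insertFirst.1 h.eq_of_ascent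
    rw [forall_le_apply_iff hv (Q := fun q => t = f q)
      fun q hq hlt => by rw [heq 0 q hq hlt]] at hlast
    exact ⟨⟨hσ, hf, fun p => by simpa using h.lt p.succ, fun p => by simpa using h.le p.succ, heq,
      fun p => (isCut_insertFirst.1 (h.isCut p.succ)).2⟩, hv, ht,
      (isCut_insertFirst.1 (h.isCut 0)).2, hlast⟩
  · rintro ⟨h, hv, ht, hcut, hlast⟩
    have hpos (p) : 0 < f p := (Nat.zero_le _).trans_lt (h.lt p)
    have hfirst : ∀ q, v ≤ (σ q).castSucc → t = f q :=
      (forall_le_apply_iff hv fun q hq hσ => by rw [h.eq_of_ascent 0 q hq hσ]).2 hlast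
    exact
      { avoids132 := avoids132_insertFirst.2 ⟨h.avoids132, hv⟩
        monotone := monotone_cons_succ.2 ⟨ht, h.monotone⟩
        lt := Fin.forall_fin_succ.2 ⟨by simp, by simpa using h.lt⟩
        le := Fin.forall_fin_succ.2 ⟨by simpa using ht.trans (h.le 0), by simpa using h.le⟩
        eq_of_ascent := forall_ascent_eq_insertFirst.2 ⟨hfirst, h.eq_of_ascent⟩
        isCut := Fin.forall_fin_succ.2
          ⟨(isCut_insertFirst_iff_of_le hv).2 ⟨fun hv => hlast hv ▸ hpos 0, hcut⟩,
            fun p => (isCut_insertFirst_iff_of_le hv).2 ⟨fun _ => hpos p, h.isCut p⟩⟩ }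

end InsertFirst

section GeneratingTree

instance {n : ℕ} (σ : Equiv.Perm (Fin n)) : DecidablePred (IsCut σ) := fun s =>
  inferInstanceAs (Decidable (∀ p q, p < q → σ p < σ q → (p : ℕ) < s → (q : ℕ) < s))

open Classical in
/-- The finite set of admissible pairs. -/
noncomputable def admissiblePairs (n : ℕ) : Finset (Equiv.Perm (Fin n) × (Fin n → ℕ)) :=
  {x ∈ Finset.univ ×ˢ Fintype.piFinset fun _ => Finset.range (n + 1) | IsAdmissible x.1 x.2}

theorem mem_admissiblePairs {n : ℕ} {x : Equiv.Perm (Fin n) × (Fin n → ℕ)} :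
    x ∈ admissiblePairs n ↔ IsAdmissible x.1 x.2 := by
  simp only [admissiblePairs, Finset.mem_filter, Finset.mem_product, Finset.mem_univ, true_and,
    Fintype.mem_piFinset, Finset.mem_range, and_iff_right_iff_imp]
  exact fun h i => Nat.lt_succ_of_le (h.le i)

variable {n : ℕ}

/-- The children of an admissible pair in the generating tree. A new first value `w` that is not
the largest one forces the first entry of the new `f`; in front of the new largest value that
entry is free to be any `t + 1` with `t` a cut up to `f 0`. -/
def child (x : Equiv.Perm (Fin (n + 1)) × (Fin (n + 1) → ℕ)) :
    Fin (n + 1) ⊕ ℕ → Equiv.Perm (Fin (n + 2)) × (Fin (n + 2) → ℕ)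
  | .inl w => (insertFirst w.castSucc x.1, Fin.cons (x.2 0 + 1) fun i => x.2 i + 1)
  | .inr t => (insertFirst (Fin.last _) x.1, Fin.cons (t + 1) fun i => x.2 i + 1)

/-- The arguments of `child` at which it yields an admissible pair. -/
def extensions (x : Equiv.Perm (Fin (n + 1)) × (Fin (n + 1) → ℕ)) : Finset (Fin (n + 1) ⊕ ℕ) :=
  (Finset.Ici (x.1 0)).disjSum {t ∈ Finset.range (x.2 0 + 1) | IsCut x.1 t}

theorem isAdmissible_child {x : Equiv.Perm (Fin (n + 1)) × (Fin (n + 1) → ℕ)}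
    {e : Fin (n + 1) ⊕ ℕ} :
    IsAdmissible (child x e).1 (child x e).2 ↔ IsAdmissible x.1 x.2 ∧ e ∈ extensions x := by
  rcases e with w | t <;> rw [child, isAdmissible_insertFirst]
  · exact and_congr_right fun h => by simp [extensions, h.isCut 0]
  · simp [extensions, Fin.le_last]

theorem child_injective : Function.Injective2 (child (n := n)) := by
  rintro ⟨σ, f⟩ ⟨τ, g⟩ e e' h
  have split {v w : Fin (n + 2)} {s t : ℕ}
      (h : (insertFirst v σ, (Fin.cons (s + 1) fun i => f i + 1 : Fin (n + 2) → ℕ)) =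
        (insertFirst w τ, Fin.cons (t + 1) fun i => g i + 1)) :
      v = w ∧ s = t ∧ σ = τ ∧ f = g := by
    obtain ⟨hperm, hcons⟩ := Prod.ext_iff.1 h
    obtain ⟨hv, hσ⟩ := insertFirst_injective hperm
    obtain ⟨hst, hfg⟩ := Fin.cons_injective2 (α := fun _ => ℕ) hcons
    exact ⟨hv, Nat.succ_injective hst, hσ, funext fun i => Nat.succ_injective (congrFun hfg i)⟩
  rcases e with w | t <;> rcases e' with w' | t' <;> obtain ⟨hv, hst, rfl, rfl⟩ := split h
  · exact ⟨rfl, congrArg _ (Fin.castSucc_injective _ hv)⟩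
  · exact absurd hv (Fin.castSucc_lt_last w).ne
  · exact absurd hv (Fin.castSucc_lt_last w').ne'
  · exact ⟨rfl, congrArg _ hst⟩

theorem IsAdmissible.exists_child {τ : Equiv.Perm (Fin (n + 2))} {g : Fin (n + 2) → ℕ}
    (h : IsAdmissible τ g) : ∃ x e, child x e = (τ, g) := by
  obtain ⟨v, σ, rfl⟩ := exists_insertFirst_eq τ
  obtain ⟨t, f, rfl⟩ : ∃ (t : ℕ) (f : Fin (n + 1) → ℕ),
      (Fin.cons (t + 1) fun i => f i + 1 : Fin (n + 2) → ℕ) = g := by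
    refine ⟨g 0 - 1, fun i => g i.succ - 1, funext (Fin.cases ?_ fun i => ?_)⟩
    · exact Nat.sub_add_cancel (h.lt 0)
    · exact Nat.sub_add_cancel ((Nat.zero_le _).trans_lt (h.lt i.succ))
  obtain ⟨-, -, -, -, hlast⟩ := isAdmissible_insertFirst.1 h
  rcases Fin.eq_castSucc_or_eq_last v with ⟨w, rfl⟩ | rfl
  · exact ⟨(σ, f), .inl w, by rw [child, hlast (Fin.castSucc_lt_last w).ne]⟩
  · exact ⟨(σ, f), .inr t, rfl⟩

theorem sum_admissiblePairs_succ {M : Type*} [AddCommMonoid M]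
    (F : Equiv.Perm (Fin (n + 2)) × (Fin (n + 2) → ℕ) → M) :
    ∑ y ∈ admissiblePairs (n + 2), F y =
      ∑ x ∈ admissiblePairs (n + 1), ∑ e ∈ extensions x, F (child x e) := by
  rw [Finset.sum_sigma']
  symm
  refine Finset.sum_bij (fun z _ => child z.1 z.2) ?_ ?_ ?_ fun _ _ => rfl
  · rintro ⟨x, e⟩ h
    rw [Finset.mem_sigma, mem_admissiblePairs] at h
    exact mem_admissiblePairs.2 (isAdmissible_child.2 h)
  · rintro ⟨x, e⟩ - ⟨x', e'⟩ - h
    obtain ⟨rfl, rfl⟩ := child_injective h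
    rfl
  · rintro ⟨τ, g⟩ h
    obtain ⟨x, e, hxe⟩ := (mem_admissiblePairs.1 h).exists_child
    rw [← hxe, mem_admissiblePairs, isAdmissible_child, ← mem_admissiblePairs] at h
    exact ⟨⟨x, e⟩, Finset.mem_sigma.2 h, hxe⟩

/-- The number of values of `σ` from its first one on, a label in the generating tree. -/
def coheight (σ : Equiv.Perm (Fin (n + 1))) : ℕ :=
  n + 1 - σ 0

/-- The number of cuts of `σ` up to the position `s`; the other label of a pair `(σ, f)` in the
generating tree is `cutRank σ (f 0)`. -/
def cutRank (σ : Equiv.Perm (Fin n)) (s : ℕ) : ℕ :=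
  Nat.count (IsCut σ) (s + 1)

theorem isCut_zero (σ : Equiv.Perm (Fin n)) : IsCut σ 0 :=
  fun _ _ _ _ h => (Nat.not_lt_zero _ h).elim

theorem coheight_insertFirst (v : Fin (n + 1)) (σ : Equiv.Perm (Fin n)) :
    coheight (insertFirst v σ) = n + 1 - v := by
  rw [coheight, insertFirst_zero]

theorem cutRank_eq_count_add_one (σ : Equiv.Perm (Fin n)) (s : ℕ) :
    cutRank σ s = Nat.count (fun t => IsCut σ (t + 1)) s + 1 := by
  rw [cutRank, Nat.count_succ', if_pos (isCut_zero σ)]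

theorem cutRank_insertFirst_castSucc {σ : Equiv.Perm (Fin (n + 1))} {w : Fin (n + 1)}
    (hw : σ 0 ≤ w) (s : ℕ) : cutRank (insertFirst w.castSucc σ) (s + 1) = cutRank σ s := by
  have isCut_iff (t : ℕ) : IsCut (insertFirst w.castSucc σ) (t + 1) ↔ 0 < t ∧ IsCut σ t := by
    simp [isCut_insertFirst_iff_of_le (Fin.castSucc_le_castSucc_iff.2 hw)]
  simp [cutRank_eq_count_add_one, isCut_iff, Nat.count_succ' _ s]

theorem cutRank_insertFirst_last {σ : Equiv.Perm (Fin (n + 1))} {t : ℕ} (ht : IsCut σ t) :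
    cutRank (insertFirst (Fin.last _) σ) (t + 1) = Nat.count (IsCut σ) t + 2 := by
  have isCut_iff (s : ℕ) : IsCut (insertFirst (Fin.last _) σ) (s + 1) ↔ IsCut σ s := by
    simp [isCut_insertFirst_iff_of_le (Fin.le_last _)]
  simp [cutRank_eq_count_add_one, isCut_iff, Nat.count_succ, ht]

theorem sum_filter_range_count {M : Type*} [AddCommMonoid M] (p : ℕ → Prop) [DecidablePred p]
    (h : ℕ → M) (m : ℕ) :
    ∑ t ∈ Finset.range m with p t, h (Nat.count p t) = ∑ i ∈ Finset.range (Nat.count p m), h i := by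
  induction m with
  | zero => simp
  | succ m ih =>
    rw [Finset.range_add_one, Finset.filter_insert, Nat.count_succ]
    split_ifs
    · rw [Finset.sum_insert (by simp), ih, Finset.sum_range_succ, add_comm]
    · exact ih

theorem sum_Ici_sub {M : Type*} [AddCommMonoid M] (h : ℕ → M) (a : Fin (n + 1)) :
    ∑ w ∈ Finset.Ici a, h (n - w) = ∑ i ∈ Finset.range (n + 1 - a), h i := by
  refine Finset.sum_bij' (fun w _ => n - w) (fun i _ => ⟨n - i, by lia⟩) ?_ ?_ ?_ ?_ ?_ <;>
    simp only [Finset.mem_Ici, Finset.mem_range, Fin.le_def, Fin.ext_iff] <;> lia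

theorem sum_extensions {M : Type*} [AddCommMonoid M] (h : ℕ → ℕ → M)
    (x : Equiv.Perm (Fin (n + 1)) × (Fin (n + 1) → ℕ)) :
    ∑ e ∈ extensions x, h (coheight (child x e).1) (cutRank (child x e).1 ((child x e).2 0)) =
      ∑ i ∈ Finset.range (coheight x.1), h (i + 2) (cutRank x.1 (x.2 0)) +
        ∑ i ∈ Finset.range (cutRank x.1 (x.2 0)), h 1 (i + 2) := by
  rw [extensions, Finset.sum_disjSum]
  congr 1
  · rw [coheight, ← sum_Ici_sub fun i => h (i + 2) (cutRank x.1 (x.2 0))]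
    refine Finset.sum_congr rfl fun w hw => ?_
    simp only [child, coheight_insertFirst, Fin.cons_zero,
      cutRank_insertFirst_castSucc (Finset.mem_Ici.1 hw), Fin.val_castSucc]
    congr 1
    lia
  · rw [cutRank, ← sum_filter_range_count _ fun i => h 1 (i + 2)]
    refine Finset.sum_congr rfl fun t ht => ?_
    simp only [child, coheight_insertFirst, Fin.cons_zero,
      cutRank_insertFirst_last (Finset.mem_filter.1 ht).2, Fin.val_last, Nat.add_sub_cancel_left]

theorem mul_sum_pow_add_two {R : Type*} [CommRing R] {a q : R} (h : q = 1 + a * q ^ 2) (m : ℕ) :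
    a * ∑ i ∈ Finset.range m, q ^ (i + 2) = q ^ m - 1 := by
  induction m with
  | zero => simp
  | succ m ih =>
    rw [Finset.sum_range_succ, mul_add, ih]
    linear_combination -q ^ m * h

/-- The generating function, by the number of generations, of the descendants in the generating
tree of a node with labels `u` and `r`. -/
noncomputable def descendantGF (u r : ℕ) : PowerSeries ℤ :=
  catalanGF ^ u * (1 + catalanMotzkinGF) ^ r

theorem descendantGF_eq (u r : ℕ) :
    descendantGF u r =
      1 + PowerSeries.X * (∑ i ∈ Finset.range u, descendantGF (i + 2) r +
        ∑ i ∈ Finset.range r, descendantGF 1 (i + 2)) := by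
  have hu := mul_sum_pow_add_two catalanGF_eq u
  have hr := mul_sum_pow_add_two (a := PowerSeries.X * catalanGF) (q := 1 + catalanMotzkinGF)
    (by linear_combination catalanMotzkinGF_eq) r
  simp only [descendantGF, ← Finset.sum_mul, ← Finset.mul_sum]
  linear_combination -(1 + catalanMotzkinGF) ^ r * hu - hr

theorem constantCoeff_descendantGF (u r : ℕ) :
    PowerSeries.constantCoeff (descendantGF u r) = 1 := by
  have constantCoeff_catalanGF : PowerSeries.constantCoeff catalanGF = 1 := by
    rw [catalanGF_eq]
    simp
  simp [descendantGF, constantCoeff_catalanGF, constantCoeff_catalanMotzkinGF]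

theorem admissiblePairs_one : admissiblePairs 1 = {(1, fun _ => 1)} := by
  ext ⟨σ, f⟩
  rw [mem_admissiblePairs, Finset.mem_singleton, Prod.mk.injEq]
  constructor
  · intro h
    exact ⟨Subsingleton.elim _ _,
      funext fun p => (h.le p).antisymm ((Nat.zero_le _).trans_lt (h.lt p))⟩
  · rintro ⟨rfl, rfl⟩
    constructor <;> simp [Avoids132, IsCut, Monotone]

theorem sum_coeff_descendantGF (n m : ℕ) :
    ∑ x ∈ admissiblePairs (n + 1),
        PowerSeries.coeff m (descendantGF (coheight x.1) (cutRank x.1 (x.2 0))) =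
      PowerSeries.coeff (m + n + 1) catalanMotzkinGF := by
  induction n generalizing m with
  | zero =>
    have root_labels : coheight (1 : Equiv.Perm (Fin 1)) = 1 ∧
        cutRank (1 : Equiv.Perm (Fin 1)) 1 = 2 := by decide
    have eq := congrArg (PowerSeries.coeff (m + 1)) catalanMotzkinGF_eq
    rw [mul_assoc, PowerSeries.coeff_succ_X_mul] at eq
    rw [admissiblePairs_one, Finset.sum_singleton, root_labels.1, root_labels.2, add_zero, eq,
      descendantGF, pow_one]
  | succ n ih =>
    rw [sum_admissiblePairs_succ, ← add_assoc, add_right_comm m, ← ih]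
    refine Finset.sum_congr rfl fun x _ => ?_
    rw [sum_extensions fun u r => PowerSeries.coeff m (descendantGF u r), descendantGF_eq, map_add,
      PowerSeries.coeff_succ_X_mul, PowerSeries.coeff_one, if_neg (Nat.succ_ne_zero m), zero_add,
      map_add, map_sum, map_sum]

theorem card_admissiblePairs_succ (n : ℕ) :
    ((admissiblePairs (n + 1)).card : ℤ) = PowerSeries.coeff (n + 1) catalanMotzkinGF := by
  have h := sum_coeff_descendantGF n 0
  simpa only [PowerSeries.coeff_zero_eq_constantCoeff_apply, constantCoeff_descendantGF,
    Finset.sum_const, nsmul_one, zero_add] using h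

end GeneratingTree

/-! ### Permutations all of whose cycles are 3-cycles of the form 312 -/

section Cycles

open Equiv

theorem exists_orderEmbedding_fin_three {α : Type*} [LinearOrder α] {a b c : α} (hab : a < b)
    (hbc : b < c) : ∃ f : Fin 3 ↪o α, f 0 = a ∧ f 1 = b ∧ f 2 = c := by
  have strictMono : StrictMono ![a, b, c] := by
    simp [Fin.strictMono_iff_lt_succ, Fin.forall_fin_two, hab, hbc]
  exact ⟨OrderEmbedding.ofStrictMono _ strictMono, rfl, rfl, rfl⟩

variable {N : ℕ} {π : Perm (Fin N)}

theorem avoidsPattern_one_three_two_iff : AvoidsPattern π ![1, 3, 2] ↔ Avoids132 π := by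
  constructor
  · intro h i j k hij hjk h1 h2
    obtain ⟨f, rfl, rfl, rfl⟩ := exists_orderEmbedding_fin_three hij hjk
    exact h f (by simp [IsOccurrence, Fin.forall_fin_succ, h1, h2, h1.le, h2.le, h1.trans h2,
      (h1.trans h2).le])
  · intro h f hf
    exact h (f 0) (f 1) (f 2) (by simp) (by simp) ((hf 0 2).2 (by simp)) ((hf 2 1).2 (by simp))

theorem cycleHasForm_three_one_two_iff {c : Perm (Fin N)} {x y z : Fin N} (hxy : x < y)
    (hyz : y < z) (hc : c.support = {x, y, z}) :
    CycleHasForm π c ![3, 1, 2] ↔ π y < π z ∧ π z < π x := by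
  obtain ⟨g, rfl, rfl, rfl⟩ := exists_orderEmbedding_fin_three hxy hyz
  have range_g : Set.range g = c.support := by
    ext
    simp [hc, Fin.exists_fin_succ, eq_comm]
  constructor
  · rintro ⟨f, hf, hfπ⟩
    obtain rfl : f = g := RelEmbedding.coe_fn_injective <|
      (f.strictMono.range_inj g.strictMono).1 (hf.trans range_g.symm)
    exact ⟨(hfπ 1 2).2 (by simp), (hfπ 2 0).2 (by simp)⟩
  · rintro ⟨h12, h20⟩
    exact ⟨g, range_g, by simp [IsOccurrence, Fin.forall_fin_succ, h12, h20, h12.le, h20.le,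
      h12.trans h20, (h12.trans h20).le]⟩

theorem cycleType_eq_replicate_iff {α : Type*} [Fintype α] [DecidableEq α] {p k : ℕ}
    [Fact p.Prime] (hα : Fintype.card α = k * p) {τ : Perm α} :
    τ.cycleType = Multiset.replicate k p ↔ τ ^ p = 1 ∧ ∀ x, τ x ≠ x := by
  have support_eq : (∀ x, τ x ≠ x) ↔ τ.cycleType.sum = k * p := by
    rw [Perm.sum_cycleType, ← hα, Finset.card_eq_iff_eq_univ, Finset.eq_univ_iff_forall]
    simp
  rw [support_eq, Perm.pow_prime_eq_one_iff, Multiset.eq_replicate, and_comm]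
  refine and_congr_right fun h => ?_
  rw [Multiset.eq_replicate_card.2 h]
  simp [(Fact.out : p.Prime).ne_zero]

theorem support_cycleOf_of_cube {α : Type*} [Fintype α] [DecidableEq α] {τ : Perm α}
    (h : ∀ x, τ (τ (τ x)) = x) {x : α} (hx : τ x ≠ x) :
    (τ.cycleOf x).support = {x, τ x, τ (τ x)} := by
  ext y
  rw [Perm.mem_support_cycleOf_iff' hx]
  simp only [Finset.mem_insert, Finset.mem_singleton]
  constructor
  · intro hs
    obtain ⟨k, rfl⟩ := hs.exists_nat_pow_eq
    induction k with
    | zero => simp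
    | succ k ih =>
      rw [pow_succ', Perm.mul_apply]
      rcases ih ⟨k, rfl⟩ with h' | h' | h' <;> simp [h', h]
  · rintro (rfl | rfl | rfl)
    · rfl
    · exact ⟨1, by simp⟩
    · exact ⟨2, by simp [sq]⟩

/-- All cycles of `π` are 3-cycles `a ↦ c ↦ b ↦ a` with `a < b < c`. The last condition excludes
the other cyclic order, `a ↦ b ↦ c ↦ a`. -/
structure AllCycles312 (π : Perm (Fin N)) : Prop where
  cube : ∀ x, π (π (π x)) = x
  ne : ∀ x, π x ≠ x
  form : ∀ x, x < π x → ¬ π x < π (π x)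

theorem AllCycles312.order_cases (h : AllCycles312 π) (x : Fin N) :
    (x < π (π x) ∧ π (π x) < π x) ∨ (π (π x) < π x ∧ π x < x) ∨ (π x < x ∧ x < π (π x)) := by
  have h1 := h.form x
  have h2 := h.form (π x)
  have h3 := h.form (π (π x))
  have h4 := h.ne x
  have h5 := h.ne (π x)
  have h6 := h.ne (π (π x))
  simp only [h.cube] at h2 h3 h5 h6
  omega

theorem AllCycles312.cycleHasForm_cycleOf (h : AllCycles312 π) (x : Fin N) :
    CycleHasForm π (π.cycleOf x) ![3, 1, 2] := by
  have of_lt_lt (y) (h1 : y < π (π y)) (h2 : π (π y) < π y) :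
      CycleHasForm π (π.cycleOf y) ![3, 1, 2] := by
    rw [cycleHasForm_three_one_two_iff h1 h2
      ((support_cycleOf_of_cube h.cube (h.ne y)).trans (by rw [Finset.pair_comm])), h.cube]
    exact ⟨h1, h2⟩
  have cycleOf_apply (y) : π.cycleOf (π y) = π.cycleOf y :=
    (Perm.SameCycle.cycleOf_eq ⟨1, by simp⟩).symm
  rcases h.order_cases x with hx | hx | hx
  · exact of_lt_lt x hx.1 hx.2
  · simpa only [cycleOf_apply] using of_lt_lt (π (π x)) (by simpa only [h.cube] using hx.1)
      (by simpa only [h.cube] using hx.2)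
  · simpa only [cycleOf_apply] using of_lt_lt (π x) (by simpa only [h.cube] using hx.1)
      (by simpa only [h.cube] using hx.2)

theorem forall_cycleHasForm_iff (hcube : ∀ x, π (π (π x)) = x) (hne : ∀ x, π x ≠ x) :
    (∀ c ∈ π.cycleFactorsFinset, CycleHasForm π c ![3, 1, 2]) ↔ AllCycles312 π := by
  constructor
  · refine fun h => ⟨hcube, hne, fun x h1 h2 => ?_⟩
    have form := h (π.cycleOf x)
      (Perm.cycleOf_mem_cycleFactorsFinset_iff.2 (Perm.mem_support.2 (hne x)))
    rw [cycleHasForm_three_one_two_iff h1 h2 (support_cycleOf_of_cube hcube (hne x)),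
      hcube] at form
    exact form.1.asymm (h1.trans h2)
  · intro h c hc
    obtain ⟨x, hx⟩ := (Perm.mem_cycleFactorsFinset_iff.1 hc).1.nonempty_support
    rw [Perm.cycle_is_cycleOf hx hc]
    exact h.cycleHasForm_cycleOf x

theorem mem_threeCyclePerms_iff {n : ℕ} {π : Perm (Fin (3 * n))} :
    π ∈ ThreeCyclePerms n ↔ (∀ x, π (π (π x)) = x) ∧ ∀ x, π x ≠ x := by
  have : Fact (Nat.Prime 3) := ⟨Nat.prime_three⟩
  rw [ThreeCyclePerms, Set.mem_ofPred_eq, cycleType_eq_replicate_iff (by simp [mul_comm]),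
    Equiv.ext_iff]
  simp [pow_succ]

theorem mem_A_iff {n : ℕ} {π : Perm (Fin (3 * n))} :
    π ∈ A n ↔ AllCycles312 π ∧ Avoids132 π := by
  rw [A, Set.mem_ofPred_eq, mem_threeCyclePerms_iff, avoidsPattern_one_three_two_iff]
  constructor
  · rintro ⟨⟨hcube, hne⟩, hav, hform⟩
    exact ⟨(forall_cycleHasForm_iff hcube hne).1 hform, hav⟩
  · rintro ⟨h, hav⟩
    exact ⟨⟨h.cube, h.ne⟩, hav, (forall_cycleHasForm_iff h.cube h.ne).2 h⟩

end Cycles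

/-! ### Layouts -/

section Layout

variable {n : ℕ} {π : Equiv.Perm (Fin (3 * n))} {σ : Equiv.Perm (Fin n)} {f : Fin n → ℕ}
  {lo mid hi : Fin n → Fin (3 * n)}

/-- The correspondence between a permutation `π` and the pair `(σ, f)` that encodes it. The cycles
of `π` are `lo i ↦ hi i ↦ mid i ↦ lo i`; the smallest elements `lo i` are `0, …, n - 1`, taken in
the order given by `σ`, the middle elements `mid i` and the largest elements `hi i` are both listed
increasingly, and exactly the first `f p` middle elements come before `hi p`. -/
structure IsLayout (π : Equiv.Perm (Fin (3 * n))) (σ : Equiv.Perm (Fin n)) (f : Fin n → ℕ)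
    (lo mid hi : Fin n → Fin (3 * n)) : Prop where
  val_lo : ∀ i, (lo i : ℕ) = σ i
  mid_strictMono : StrictMono mid
  hi_strictMono : StrictMono hi
  le_mid : ∀ i, n ≤ (mid i : ℕ)
  le_hi : ∀ i, n ≤ (hi i : ℕ)
  le : ∀ i, f i ≤ n
  lt : ∀ i : Fin n, (i : ℕ) < f i
  mid_lt_hi_iff : ∀ i p, mid i < hi p ↔ (i : ℕ) < f p
  apply_lo : ∀ i, π (lo i) = hi i
  apply_mid : ∀ i, π (mid i) = lo i
  apply_hi : ∀ i, π (hi i) = mid i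
  cover : ∀ x, (∃ i, lo i = x) ∨ (∃ i, mid i = x) ∨ ∃ i, hi i = x

theorem eq_of_forall_fin_lt_iff {a b n : ℕ} (ha : a ≤ n) (hb : b ≤ n)
    (h : ∀ i : Fin n, (i : ℕ) < a ↔ (i : ℕ) < b) : a = b :=
  le_antisymm (le_of_forall_lt fun i hi => (h ⟨i, hi.trans_le ha⟩).1 hi)
    (le_of_forall_lt fun i hi => (h ⟨i, hi.trans_le hb⟩).2 hi)

theorem eq_of_forall_lt_imp_lt {α β : Type*} [LinearOrder β] [WellFoundedLT β] {p q : α → β}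
    (hp : Function.Bijective p) (hq : Function.Surjective q)
    (h : ∀ u v, p u < p v → q u < q v) : p = q := by
  let e := Equiv.ofBijective p hp
  have strictMono : StrictMono (q ∘ e.symm) := fun x y hxy =>
    h _ _ (by rwa [← e.apply_symm_apply x, ← e.apply_symm_apply y] at hxy)
  have eq_id : q ∘ e.symm = id :=
    (strictMono.range_inj strictMono_id).1 <| by
      rw [Set.range_id, (hq.comp e.symm.surjective).range_eq]
  exact ((Equiv.comp_symm_eq e id q).1 eq_id).symm

namespace IsLayout

theorem lo_lt (h : IsLayout π σ f lo mid hi) (i : Fin n) : (lo i : ℕ) < n :=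
  (h.val_lo i).trans_lt (σ i).2

theorem lo_lt_lo_iff (h : IsLayout π σ f lo mid hi) {i j : Fin n} : lo i < lo j ↔ σ i < σ j := by
  rw [Fin.lt_def, h.val_lo, h.val_lo, Fin.lt_def]

theorem lo_lt_mid (h : IsLayout π σ f lo mid hi) (i j : Fin n) : lo i < mid j :=
  Fin.lt_def.2 ((h.lo_lt i).trans_le (h.le_mid j))

theorem lo_lt_hi (h : IsLayout π σ f lo mid hi) (i j : Fin n) : lo i < hi j :=
  Fin.lt_def.2 ((h.lo_lt i).trans_le (h.le_hi j))

theorem mid_lt_hi (h : IsLayout π σ f lo mid hi) (i : Fin n) : mid i < hi i :=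
  (h.mid_lt_hi_iff i i).2 (h.lt i)

theorem mid_ne_hi (h : IsLayout π σ f lo mid hi) (i j : Fin n) : mid i ≠ hi j := by
  intro he
  have apply_eq := h.apply_mid i
  rw [he, h.apply_hi] at apply_eq
  exact (h.lo_lt_mid i j).ne' apply_eq

theorem hi_lt_mid_iff (h : IsLayout π σ f lo mid hi) {i p : Fin n} : hi p < mid i ↔ f p ≤ i := by
  rw [← not_lt, ← h.mid_lt_hi_iff, not_lt, le_iff_lt_or_eq,
    or_iff_left (h.mid_ne_hi i p).symm]

theorem monotone (h : IsLayout π σ f lo mid hi) : Monotone f := by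
  intro p q hpq
  refine le_of_forall_lt fun i hi' => ?_
  have mid_lt := (h.mid_lt_hi_iff ⟨i, hi'.trans_le (h.le p)⟩ p).2 hi'
  exact (h.mid_lt_hi_iff _ q).1 (mid_lt.trans_le (h.hi_strictMono.monotone hpq))

theorem allCycles312 (h : IsLayout π σ f lo mid hi) : AllCycles312 π := by
  refine ⟨fun x => ?_, fun x => ?_, fun x => ?_⟩ <;>
  rcases h.cover x with ⟨i, rfl⟩ | ⟨i, rfl⟩ | ⟨i, rfl⟩ <;>
  simp only [h.apply_lo, h.apply_mid, h.apply_hi]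
  · exact (h.lo_lt_hi i i).ne'
  · exact (h.lo_lt_mid i i).ne
  · exact (h.mid_lt_hi i).ne
  · exact fun _ => (h.mid_lt_hi i).asymm
  · exact fun hlt => absurd hlt (h.lo_lt_mid i i).asymm
  · exact fun hlt => absurd hlt (h.mid_lt_hi i).asymm

theorem isAdmissible (h : IsLayout π σ f lo mid hi) (hav : Avoids132 π) : IsAdmissible σ f where
  monotone := h.monotone
  lt := h.lt
  le := h.le
  avoids132 i j k hij hjk hik hkj := by
    apply hav (mid i) (mid j) (mid k) (h.mid_strictMono hij) (h.mid_strictMono hjk) <;>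
    rwa [h.apply_mid, h.apply_mid, h.lo_lt_lo_iff]
  eq_of_ascent p q hpq hσ := by
    refine (h.monotone hpq.le).antisymm (not_lt.1 fun hlt => ?_)
    let r : Fin n := ⟨f p, hlt.trans_le (h.le q)⟩
    apply hav (lo p) (lo q) (hi r) (h.lo_lt_lo_iff.2 hσ) (h.lo_lt_hi _ _)
    · rw [h.apply_lo, h.apply_hi, h.hi_lt_mid_iff]
    · rwa [h.apply_lo, h.apply_hi, h.mid_lt_hi_iff]
  isCut r p q _ hσ hp := by
    by_contra! hq
    apply hav (mid p) (hi r) (mid q) ((h.mid_lt_hi_iff p r).2 hp) (h.hi_lt_mid_iff.2 hq)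
    · rwa [h.apply_mid, h.apply_mid, h.lo_lt_lo_iff]
    · rw [h.apply_mid, h.apply_hi]
      exact h.lo_lt_mid _ _

theorem exists_lo_eq_of_lt (h : IsLayout π σ f lo mid hi) {x : Fin (3 * n)} {i : Fin n}
    (hx : x < lo i) : ∃ p, lo p = x := by
  rcases h.cover x with hlo | ⟨p, rfl⟩ | ⟨p, rfl⟩
  · exact hlo
  · exact absurd hx (h.lo_lt_mid i p).asymm
  · exact absurd hx (h.lo_lt_hi i p).asymm

theorem exists_mid_eq_of_apply_lt (h : IsLayout π σ f lo mid hi) {x : Fin (3 * n)} {i : Fin n}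
    (hx : π x < lo i) : ∃ p, mid p = x := by
  obtain ⟨p, hp⟩ := h.exists_lo_eq_of_lt hx
  exact ⟨p, π.injective ((h.apply_mid p).trans hp)⟩

theorem avoids132 (h : IsLayout π σ f lo mid hi) (ha : IsAdmissible σ f) : Avoids132 π := by
  intro i j k hij hjk hik hkj
  rcases h.cover j with ⟨q, rfl⟩ | ⟨q, rfl⟩ | ⟨q, rfl⟩
  · obtain ⟨p, rfl⟩ := h.exists_lo_eq_of_lt hij
    rcases h.cover k with ⟨r, rfl⟩ | ⟨r, rfl⟩ | ⟨r, rfl⟩ <;>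
    simp only [h.apply_lo, h.apply_mid, h.apply_hi, h.lo_lt_lo_iff, h.hi_lt_mid_iff,
      h.mid_lt_hi_iff, h.hi_strictMono.lt_iff_lt] at hij hjk hik hkj
    · exact ha.avoids132 p r q hik hkj hij hjk
    · exact (h.lo_lt_hi r p).asymm hik
    · have hpq : p < q := not_le.1 fun hqp => (hik.trans_lt hkj).not_ge (h.monotone hqp)
      exact (hik.trans_lt hkj).ne (ha.eq_of_ascent p q hpq hij)
  · rw [h.apply_mid] at hkj
    obtain ⟨r, rfl⟩ := h.exists_mid_eq_of_apply_lt hkj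
    rw [h.apply_mid] at hik hkj
    obtain ⟨p, rfl⟩ := h.exists_mid_eq_of_apply_lt hik
    rw [h.apply_mid] at hik
    exact ha.avoids132 p q r (h.mid_strictMono.lt_iff_lt.1 hij) (h.mid_strictMono.lt_iff_lt.1 hjk)
      (h.lo_lt_lo_iff.1 hik) (h.lo_lt_lo_iff.1 hkj)
  · rcases h.cover k with ⟨r, rfl⟩ | ⟨r, rfl⟩ | ⟨r, rfl⟩
    · exact (h.lo_lt_hi r q).asymm hjk
    · rw [h.apply_mid] at hik
      obtain ⟨p, rfl⟩ := h.exists_mid_eq_of_apply_lt hik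
      rw [h.apply_mid] at hik
      exact (ha.isCut q p r (h.mid_strictMono.lt_iff_lt.1 (hij.trans hjk)) (h.lo_lt_lo_iff.1 hik)
        ((h.mid_lt_hi_iff p q).1 hij)).not_ge (h.hi_lt_mid_iff.1 hjk)
    · rw [h.apply_hi, h.apply_hi] at hkj
      exact (h.mid_strictMono (h.hi_strictMono.lt_iff_lt.1 hjk)).asymm hkj

theorem pair_unique {σ' : Equiv.Perm (Fin n)} {f' : Fin n → ℕ}
    {lo' mid' hi' : Fin n → Fin (3 * n)} (h : IsLayout π σ f lo mid hi)
    (h' : IsLayout π σ' f' lo' mid' hi') : σ = σ' ∧ f = f' := by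
  have range_hi {σ f lo mid hi} (h : IsLayout π σ f lo mid hi) :
      Set.range hi = {x | π x < x ∧ π (π x) < π x} := by
    ext x
    rw [Set.mem_ofPred_eq]
    rcases h.cover x with ⟨i, rfl⟩ | ⟨i, rfl⟩ | ⟨i, rfl⟩
    · simp [h.apply_lo, (h.lo_lt_hi _ _).ne', (h.lo_lt_hi i i).asymm]
    · simp [h.apply_mid, h.apply_lo, (h.mid_ne_hi i _).symm, (h.lo_lt_hi i i).asymm]
    · simp [h.apply_hi, h.apply_mid, h.mid_lt_hi, h.lo_lt_mid]
  obtain rfl : hi = hi' :=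
    (h.hi_strictMono.range_inj h'.hi_strictMono).1 ((range_hi h).trans (range_hi h').symm)
  have mid_eq (i) : mid i = mid' i := by rw [← h.apply_hi, h'.apply_hi]
  refine ⟨Equiv.ext fun i => Fin.ext ?_, funext fun p => ?_⟩
  · rw [← h.val_lo, ← h'.val_lo, ← h.apply_mid, ← h'.apply_mid, mid_eq]
  · exact eq_of_forall_fin_lt_iff (h.le p) (h'.le p) fun i => by
      rw [← h.mid_lt_hi_iff, ← h'.mid_lt_hi_iff, mid_eq]

theorem surjective (h : IsLayout π σ f lo mid hi) :
    Function.Surjective (Sum.elim lo (Sum.elim mid hi)) := fun x => by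
  simpa using h.cover x

theorem bijective (h : IsLayout π σ f lo mid hi) :
    Function.Bijective (Sum.elim lo (Sum.elim mid hi)) :=
  (Fintype.bijective_iff_surjective_and_card _).2 ⟨h.surjective, by simp; ring⟩

theorem perm_unique {π' : Equiv.Perm (Fin (3 * n))} {lo' mid' hi' : Fin n → Fin (3 * n)}
    (h : IsLayout π σ f lo mid hi) (h' : IsLayout π' σ f lo' mid' hi') : π = π' := by
  have points_eq : Sum.elim lo (Sum.elim mid hi) = Sum.elim lo' (Sum.elim mid' hi') := by
    refine eq_of_forall_lt_imp_lt h.bijective h'.surjective ?_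
    rintro (i | i | i) (j | j | j) hlt <;> simp only [Sum.elim_inl, Sum.elim_inr] at hlt ⊢
    · rwa [h.lo_lt_lo_iff, ← h'.lo_lt_lo_iff] at hlt
    · exact h'.lo_lt_mid _ _
    · exact h'.lo_lt_hi _ _
    · exact absurd hlt (h.lo_lt_mid _ _).asymm
    · exact h'.mid_strictMono (h.mid_strictMono.lt_iff_lt.1 hlt)
    · rwa [h.mid_lt_hi_iff, ← h'.mid_lt_hi_iff] at hlt
    · exact absurd hlt (h.lo_lt_hi _ _).asymm
    · rwa [h.hi_lt_mid_iff, ← h'.hi_lt_mid_iff] at hlt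
    · exact h'.hi_strictMono (h.hi_strictMono.lt_iff_lt.1 hlt)
  obtain ⟨rfl, rfl, rfl⟩ : lo = lo' ∧ mid = mid' ∧ hi = hi' := by
    simpa [Sum.elim_eq_iff] using points_eq
  ext x
  rcases h.cover x with ⟨i, rfl⟩ | ⟨i, rfl⟩ | ⟨i, rfl⟩
  · rw [h.apply_lo, h'.apply_lo]
  · rw [h.apply_mid, h'.apply_mid]
  · rw [h.apply_hi, h'.apply_hi]

end IsLayout

theorem lt_card_filter_iff_of_antitone {N : ℕ} {P : Fin N → Prop} [DecidablePred P]
    (hP : Antitone P) (x : Fin N) : (x : ℕ) < (Finset.univ.filter P).card ↔ P x := by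
  constructor
  · intro hx
    by_contra hPx
    have subset : Finset.univ.filter P ⊆ Finset.Iio x := fun y hy =>
      Finset.mem_Iio.2 (not_le.1 fun hxy => hPx (hP hxy (Finset.mem_filter.1 hy).2))
    exact ((Finset.card_le_card subset).trans_eq (Fin.card_Iio x)).not_gt hx
  · intro hPx
    have subset : Finset.Iic x ⊆ Finset.univ.filter P := fun y hy =>
      Finset.mem_filter.2 ⟨Finset.mem_univ y, hP (Finset.mem_Iic.1 hy) hPx⟩
    exact Nat.lt_of_succ_le ((Fin.card_Iic x).symm.trans_le (Finset.card_le_card subset))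

/-- The largest elements of the cycles of `π`, when these are 3-cycles `a ↦ c ↦ b ↦ a` with
`a < b < c`: the starting points of two consecutive descents along `π`. -/
def cycleMaxima {N : ℕ} (π : Equiv.Perm (Fin N)) : Finset (Fin N) :=
  Finset.univ.filter fun x => π x < x ∧ π (π x) < π x

theorem mem_cycleMaxima {N : ℕ} {π : Equiv.Perm (Fin N)} {x : Fin N} :
    x ∈ cycleMaxima π ↔ π x < x ∧ π (π x) < π x := by
  simp [cycleMaxima]

namespace AllCycles312

variable {N : ℕ} {π : Equiv.Perm (Fin N)}

theorem apply_mem_cycleMaxima_iff (h : AllCycles312 π) {x : Fin N} :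
    π x ∈ cycleMaxima π ↔ x < π x := by
  have cases := h.order_cases x
  rw [mem_cycleMaxima, h.cube]
  omega

theorem exists_mem_cycleMaxima (h : AllCycles312 π) (x : Fin N) :
    ∃ y ∈ cycleMaxima π, π (π y) = x ∨ π y = x ∨ y = x := by
  rcases h.order_cases x with hx | hx | hx
  · exact ⟨π x, mem_cycleMaxima.2 (by simpa only [h.cube] using hx.symm), Or.inl (h.cube x)⟩
  · exact ⟨x, mem_cycleMaxima.2 hx.symm, Or.inr (Or.inr rfl)⟩
  · exact ⟨π (π x), mem_cycleMaxima.2 (by simpa only [h.cube] using hx.symm),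
      Or.inr (Or.inl (h.cube x))⟩

theorem three_mul_card_cycleMaxima (h : AllCycles312 π) : 3 * (cycleMaxima π).card = N := by
  let indicator (x : Fin N) : ℕ := if x ∈ cycleMaxima π then 1 else 0
  have sum_cycle (x) : indicator x + indicator (π x) + indicator (π (π x)) = 1 := by
    have cases := h.order_cases x
    simp only [indicator, mem_cycleMaxima, h.cube]
    split_ifs <;> omega
  have sum_eq : ∑ x, indicator x = (cycleMaxima π).card := by simp [indicator]
  calc 3 * (cycleMaxima π).card
      = ∑ x, indicator x + ∑ x, indicator (π x) + ∑ x, indicator (π (π x)) := by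
        rw [Equiv.sum_comp π fun x => indicator (π x), Equiv.sum_comp π indicator, sum_eq]
        ring
    _ = ∑ x : Fin N, 1 := by
        rw [← Finset.sum_add_distrib, ← Finset.sum_add_distrib]
        exact Finset.sum_congr rfl fun x _ => sum_cycle x
    _ = N := by simp

theorem lt_of_apply_lt_of_lt_apply (h : AllCycles312 π) (hav : Avoids132 π) {x y : Fin N}
    (hx : π x < x) (hy : y < π y) : y < x := by
  by_contra hyx
  have hxy : x < y := (not_lt.1 hyx).lt_of_ne (by rintro rfl; exact hx.asymm hy)
  have hy' : y < π (π y) := by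
    have cases := h.order_cases y
    omega
  -- `x < y < π (π y)` carry the values `π x < y < π y`.
  refine hav x y (π (π y)) hxy hy' ?_ ?_
  · rw [h.cube]
    exact hx.trans hxy
  · rwa [h.cube]

theorem lt_apply_iff (h : AllCycles312 π) (hav : Avoids132 π) {x : Fin N} :
    x < π x ↔ (x : ℕ) < (cycleMaxima π).card := by
  have antitone : Antitone fun x => x < π x := fun x y hxy hy => by
    by_contra hx
    exact (h.lt_of_apply_lt_of_lt_apply hav ((not_lt.1 hx).lt_of_ne (h.ne x)) hy).not_ge hxy
  have card_eq : (Finset.univ.filter fun x => x < π x).card = (cycleMaxima π).card :=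
    Finset.card_equiv π fun x => by simp [h.apply_mem_cycleMaxima_iff]
  rw [← card_eq, lt_card_filter_iff_of_antitone antitone]

theorem apply_apply_lt_card (h : AllCycles312 π) (hav : Avoids132 π) {x : Fin N}
    (hx : x ∈ cycleMaxima π) : (π (π x) : ℕ) < (cycleMaxima π).card := by
  rw [← h.lt_apply_iff hav, h.cube]
  exact (mem_cycleMaxima.1 hx).2.trans (mem_cycleMaxima.1 hx).1

theorem card_le_apply (h : AllCycles312 π) (hav : Avoids132 π) {x : Fin N}
    (hx : x ∈ cycleMaxima π) : (cycleMaxima π).card ≤ (π x : ℕ) :=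
  not_lt.1 fun hlt => (mem_cycleMaxima.1 hx).2.asymm ((h.lt_apply_iff hav).2 hlt)

theorem strictMonoOn_cycleMaxima (h : AllCycles312 π) (hav : Avoids132 π) :
    StrictMonoOn π (cycleMaxima π) := by
  intro x hx y hy hxy
  by_contra hle
  -- `π x < x < y` carry the values `π (π x) < π y < π x`.
  refine hav (π x) x y (mem_cycleMaxima.1 hx).1 hxy ?_
    ((not_lt.1 hle).lt_of_ne (π.injective.ne hxy.ne'))
  exact Fin.lt_def.2 ((h.apply_apply_lt_card hav hx).trans_le (h.card_le_apply hav hy))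

theorem exists_isLayout {n : ℕ} {π : Equiv.Perm (Fin (3 * n))} (h : AllCycles312 π)
    (hav : Avoids132 π) : ∃ σ f lo mid hi, IsLayout π σ f lo mid hi := by
  have card_eq : (cycleMaxima π).card = n := by
    simpa using h.three_mul_card_cycleMaxima
  let hi := (cycleMaxima π).orderEmbOfFin card_eq
  have hi_mem (i) : hi i ∈ cycleMaxima π := Finset.orderEmbOfFin_mem _ card_eq i
  have range_hi : Set.range hi = cycleMaxima π := Finset.range_orderEmbOfFin _ card_eq
  have lo_lt (i) : (π (π (hi i)) : ℕ) < n := by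
    simpa only [card_eq] using h.apply_apply_lt_card hav (hi_mem i)
  have le_mid (i) : n ≤ (π (hi i) : ℕ) := by
    simpa only [card_eq] using h.card_le_apply hav (hi_mem i)
  have mid_lt_hi (i) : π (hi i) < hi i := (mem_cycleMaxima.1 (hi_mem i)).1
  have mid_strictMono : StrictMono fun i => π (hi i) := fun i j hij =>
    h.strictMonoOn_cycleMaxima hav (hi_mem i) (hi_mem j) (hi.strictMono hij)
  have lo_injective : Function.Injective fun i => (⟨π (π (hi i)), lo_lt i⟩ : Fin n) := by
    intro i j hij
    simpa [Fin.val_inj] using hij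
  let f (p : Fin n) : ℕ := (Finset.univ.filter fun i => π (hi i) < hi p).card
  have mid_lt_hi_iff (i p) : π (hi i) < hi p ↔ (i : ℕ) < f p :=
    (lt_card_filter_iff_of_antitone
      (fun _ _ hij hlt => (mid_strictMono.monotone hij).trans_lt hlt) i).symm
  refine ⟨Equiv.ofBijective _ (Finite.injective_iff_bijective.1 lo_injective), f,
    fun i => π (π (hi i)), fun i => π (hi i), hi, fun _ => rfl, mid_strictMono, hi.strictMono,
    le_mid, fun i => (le_mid i).trans (mid_lt_hi i).le, fun p => ?_,
    fun p => (mid_lt_hi_iff p p).1 (mid_lt_hi p), mid_lt_hi_iff, fun i => h.cube _, fun _ => rfl,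
    fun _ => rfl, fun x => ?_⟩
  · exact (Finset.card_le_univ _).trans_eq (Fintype.card_fin n)
  · obtain ⟨y, hy, hyx⟩ := h.exists_mem_cycleMaxima x
    obtain ⟨i, rfl⟩ : y ∈ Set.range hi := range_hi ▸ hy
    exact hyx.imp (⟨i, ·⟩) (Or.imp (⟨i, ·⟩) (⟨i, ·⟩))

end AllCycles312

theorem exists_perm_rotating {ι α : Type*} {lo mid hi : ι → α}
    (h : Function.Bijective (Sum.elim lo (Sum.elim mid hi))) :
    ∃ π : Equiv.Perm α, ∀ i, π (lo i) = hi i ∧ π (mid i) = lo i ∧ π (hi i) = mid i := by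
  let e := Equiv.ofBijective _ h
  let rotation := (Equiv.sumComm ι (ι ⊕ ι)).trans (Equiv.sumAssoc ι ι ι)
  have apply (u) : (e.symm.trans (rotation.trans e)) (e u) = e (rotation u) := by simp
  exact ⟨e.symm.trans (rotation.trans e), fun i =>
    ⟨apply (Sum.inl i), apply (Sum.inr (Sum.inl i)), apply (Sum.inr (Sum.inr i))⟩⟩

theorem exists_shuffle (hmono : Monotone f) (hle : ∀ p, f p ≤ n) :
    ∃ mid hi : Fin n → Fin (3 * n), StrictMono mid ∧ StrictMono hi ∧ (∀ i, n ≤ (mid i : ℕ)) ∧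
      (∀ i, n ≤ (hi i : ℕ)) ∧ ∀ i p, (mid i < hi p ↔ (i : ℕ) < f p) ∧ mid i ≠ hi p := by
  let count (i : Fin n) : ℕ := (Finset.univ.filter fun q => f q ≤ i).card
  have count_le (i) : count i ≤ n := (Finset.card_le_univ _).trans_eq (Fintype.card_fin n)
  have count_mono : Monotone count := fun i j hij =>
    Finset.card_le_card (Finset.monotone_filter_right _ fun q _ hq => hq.trans hij)
  have lt_count_iff (i p : Fin n) : (p : ℕ) < count i ↔ f p ≤ i :=
    lt_card_filter_iff_of_antitone (fun _ _ hpq hq => (hmono hpq).trans hq) p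
  -- Each entry is placed after its predecessors in its own list and in the other one.
  let mid (i : Fin n) : Fin (3 * n) := ⟨n + i + count i, by have := count_le i; omega⟩
  let hi (i : Fin n) : Fin (3 * n) := ⟨n + i + f i, by have := hle i; omega⟩
  refine ⟨mid, hi, fun i j hij => ?_, fun i j hij => ?_, fun i => ?_, fun i => ?_, fun i p => ?_⟩
  · exact Fin.lt_def.2 (add_lt_add_of_lt_of_le (Nat.add_lt_add_left hij n) (count_mono hij.le))
  · exact Fin.lt_def.2 (add_lt_add_of_lt_of_le (Nat.add_lt_add_left hij n) (hmono hij.le))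
  · exact (Nat.le_add_right n i).trans (Nat.le_add_right _ _)
  · exact (Nat.le_add_right n i).trans (Nat.le_add_right _ _)
  · have := lt_count_iff i p
    simp only [mid, hi, Fin.lt_def, ne_eq, Fin.mk.injEq]
    omega

theorem IsAdmissible.exists_isLayout (h : IsAdmissible σ f) :
    ∃ π lo mid hi, IsLayout π σ f lo mid hi := by
  obtain ⟨mid, hi, mid_strictMono, hi_strictMono, le_mid, le_hi, mid_cmp_hi⟩ :=
    exists_shuffle h.monotone h.le
  let lo (i : Fin n) : Fin (3 * n) := ⟨σ i, by omega⟩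
  have lo_injective : Function.Injective lo := fun i j hij =>
    σ.injective (Fin.ext (Fin.mk.inj hij))
  have lo_lt {i : Fin n} {x : Fin (3 * n)} (hx : n ≤ (x : ℕ)) : lo i < x :=
    Fin.lt_def.2 ((σ i).2.trans_le hx)
  have bijective : Function.Bijective (Sum.elim lo (Sum.elim mid hi)) := by
    rw [Fintype.bijective_iff_injective_and_card]
    refine ⟨lo_injective.sumElim (mid_strictMono.injective.sumElim hi_strictMono.injective
      fun i p => (mid_cmp_hi i p).2) ?_, by simp; ring⟩
    rintro i (p | p)
    exacts [(lo_lt (le_mid p)).ne, (lo_lt (le_hi p)).ne]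
  obtain ⟨π, hπ⟩ := exists_perm_rotating bijective
  exact ⟨π, lo, mid, hi,
    { val_lo := fun _ => rfl
      mid_strictMono := mid_strictMono
      hi_strictMono := hi_strictMono
      le_mid := le_mid
      le_hi := le_hi
      le := h.le
      lt := h.lt
      mid_lt_hi_iff := fun i p => (mid_cmp_hi i p).1
      apply_lo := fun i => (hπ i).1
      apply_mid := fun i => (hπ i).2.1
      apply_hi := fun i => (hπ i).2.2
      cover := fun x => by simpa using bijective.2 x }⟩

end Layout

theorem ncard_A (n : ℕ) : (A n).ncard = (admissiblePairs n).card := by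
  classical
  let encodes (π : Equiv.Perm (Fin (3 * n))) (x : Equiv.Perm (Fin n) × (Fin n → ℕ)) : Prop :=
    ∃ lo mid hi, IsLayout π x.1 x.2 lo mid hi
  rw [Set.ncard_eq_toFinset_card']
  refine le_antisymm
    (Finset.card_le_card_of_forall_subsingleton encodes (fun π hπ => ?_) fun x _ => ?_)
    (Finset.card_le_card_of_forall_subsingleton' encodes (fun x hx => ?_) fun π _ => ?_)
  · obtain ⟨hcycles, hav⟩ := mem_A_iff.1 (Set.mem_toFinset.1 hπ)
    obtain ⟨σ, f, lo, mid, hi, h⟩ := hcycles.exists_isLayout hav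
    exact ⟨(σ, f), mem_admissiblePairs.2 (h.isAdmissible hav), lo, mid, hi, h⟩
  · rintro π ⟨_, _, _, _, h⟩ π' ⟨_, _, _, _, h'⟩
    exact h.perm_unique h'
  · rw [mem_admissiblePairs] at hx
    obtain ⟨π, lo, mid, hi, h⟩ := hx.exists_isLayout
    exact ⟨π, Set.mem_toFinset.2 (mem_A_iff.2 ⟨h.allCycles312, h.avoids132 hx⟩), lo, mid, hi, h⟩
  · rintro x ⟨_, _, _, _, h⟩ y ⟨_, _, _, _, h'⟩
    obtain ⟨h1, h2⟩ := h.pair_unique h'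
    exact Prod.ext h1 h2

theorem mainTheorem3 :
    (∀ n : ℕ, 1 ≤ n →
      (A n).ncard =
        ∑ k ∈ Finset.Icc 1 n, motzkin (k - 1) *
          ∑ X ∈ compositionsOfLength n k, (X.blocks.map catalan).prod) ∧
    AGF = (catalanGF - 1) * PowerSeries.subst (catalanGF - 1) motzkinGF := by
  have ncard_eq_coeff (n : ℕ) (hn : 1 ≤ n) :
      ((A n).ncard : ℤ) = PowerSeries.coeff n catalanMotzkinGF := by
    obtain ⟨m, rfl⟩ := Nat.exists_eq_add_of_le' hn
    rw [ncard_A, card_admissiblePairs_succ]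
  refine ⟨fun n hn => ?_, ?_⟩
  · exact_mod_cast (ncard_eq_coeff n hn).trans (coeff_catalanMotzkinGF n)
  · change AGF = catalanMotzkinGF
    ext n
    rw [AGF, PowerSeries.coeff_mk]
    split_ifs with hn
    · rw [hn, PowerSeries.coeff_zero_eq_constantCoeff_apply, constantCoeff_catalanMotzkinGF]
    · exact ncard_eq_coeff n (Nat.one_le_iff_ne_zero.2 hn)
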